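/- **Theorem.** Let $G_4=\langle s,t\mid s^3=t^3=1,\ sts=tst\rangle$, let $R=\mathbb Z[\xi_1,\xi_2]$ be the polynomial ring in two indeterminates, and let $\mathcal H$ be the Hecke algebra of $G_4$, i.e. the associative unital $R$-algebra generated by $T_s,T_t$ subject to $T_sT_tT_s=T_tT_sT_t$ and $T_x^3=1+\xi_1T_x+\xi_2T_x^2$ for $x\in\{s,t\}$. For a word $w=x_1\cdots x_k$ in $s,t$ put $T_w=T_{x_1}\cdots T_{x_k}$. Let $B_{sts}$ be the family of the $T_w$, where $w$ runs through the 24 words $$1,s,t,s^2,t^2,st,ts,st^2,t^2s,s^2t,ts^2,s^2t^2,t^2s^2,st^2s,ts^2t,s^2ts^2,t^2st^2,ststst,sts,sts^2,s^2ts,s^2t^2s,st^2s^2,s^2t^2s^2 .$$ These words are reduced, they represent every element of $G_4$ exactly once, and $B_{sts}$ is an $R$-basis of $\mathcal H$. Let $h\in\mathcal H$, and write $r_w\in R$ for its coefficients with respect to $B_{sts}$, so that $h=\sum_w r_wT_w$. Then $h$ lies in the centre $Z(\mathcal H)$ if and only if * [C1] $r_{s^2t}=r_{ts^2}=(1+\xi_1\xi_2)r_{t^2s}+\xi_1r_{s^2}+\xi_1(\xi_1+\xi_2^2)r_{t^2s^2}$,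 * [C2] $r_{sts}=r_{t^2s}+\xi_1r_{ts}+\xi_1^2r_{t^2s^2}+\xi_1r_{s^2}-\xi_2r_s$, * [C3] $r_t=r_s+\xi_1r_{t^2s}+\xi_1\xi_2r_{t^2s^2}$, * [C4] $r_{s^2ts}=r_{sts^2}=r_s+\xi_1(2+\xi_1\xi_2)r_{t^2s}+\xi_1^2r_{s^2}+\xi_1(\xi_2+\xi_1\xi_2^2+\xi_1^2)r_{t^2s^2}$, * [C5] $r_{st^2s}=r_{t^2s^2}+\xi_1r_{t^2s}-\xi_2r_{s^2}$, * [C6] $r_{ts^2t}=(1+2\xi_1\xi_2+\xi_2^3)r_{t^2s^2}+\xi_2r_{s^2}+(\xi_1+\xi_2^2)r_{t^2s}$, * [C7] $r_{s^2ts^2}=r_{ts}+\xi_2(1+\xi_1\xi_2)r_{t^2s}+\xi_1\xi_2r_{s^2}+\xi_1\xi_2(\xi_1+\xi_2^2)r_{t^2s^2}$, * [C8] $r_{t^2st^2}=r_{ts}+\xi_2(2+\xi_1\xi_2)r_{t^2s}+\xi_1\xi_2r_{s^2}+\xi_2(\xi_2+\xi_1\xi_2^2+\xi_1^2)r_{t^2s^2}$,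 * [C9] $r_{s^2t^2s}=r_{st^2s^2}=r_{s^2}+\xi_1r_{t^2s^2}$, * [C10] $r_{t^2}=r_{s^2}$, * [C11] $r_{s^2t^2s^2}=r_{t^2s}+\xi_2r_{t^2s^2}$, * [C12] $r_{st}=r_{ts}$, * [C13] $r_{st^2}=r_{t^2s}$, * [C14] $r_{s^2t^2}=r_{t^2s^2}$. Moreover, $\mathcal M=\{1,s,s^2,ts,t^2s,t^2s^2,tststs\}$ is a distinguished set for $Z(\mathcal H)$. That is: each word of $\mathcal M$ is obtained by braid moves $sts\leftrightarrow tst$ from the word of $B_{sts}$ that represents the same group element; each conjugacy class of $G_4$ contains the element represented by exactly one word of $\mathcal M$; and there are $a_{g,w}\in R$ such that $h\in\mathcal H$ is central if and only if $r_g=\sum_{w\in\mathcal M}a_{g,w}r_w$ for all $g\in G_4$ not represented in $\mathcal M$ (here coefficients are indexed by group elements). Consequently $Z(\mathcal H)$ has an $R$-basis $\{b_w\mid w\in\mathcal M\}$ such that the coefficient of $b_w$ at $T_w$ is $1$ and its coefficient at $T_v$ is $0$ for every $v\in\mathcal M\setminus\{w\}$. -/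

import Mathlib

namespace HeckeG4

/-- The generating set `S = {s, t}` of the complex reflection group `G₄`. -/
inductive Gen where
  | s : Gen
  | t : Gen

/-- Words in the generators (with positive exponents). -/
abbrev Word : Type := List Gen

/-! ### The group `G₄ = ⟨s, t ∣ s³ = t³ = 1, sts = tst⟩` -/

/-- The defining relators of `G₄`. -/
def relators : Set (FreeGroup Gen) :=
  {FreeGroup.of Gen.s ^ 3, FreeGroup.of Gen.t ^ 3,
    FreeGroup.of Gen.s * FreeGroup.of Gen.t * FreeGroup.of Gen.s *
      (FreeGroup.of Gen.t * FreeGroup.of Gen.s * FreeGroup.of Gen.t)⁻¹}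

/-- The complex reflection group `G₄`. -/
abbrev W : Type := PresentedGroup relators

/-- The pseudo-reflection in `G₄` belonging to a generator. -/
def refl (x : Gen) : W := PresentedGroup.of x

/-- The element of `G₄` represented by a word. -/
def grp (w : Word) : W := (w.map refl).prod

/-- A word is reduced if no shorter word represents the same element of `G₄`. -/
def IsReduced (w : Word) : Prop :=
  ∀ v : Word, grp v = grp w → w.length ≤ v.length

/-- One application of the braid relation `sts = tst` inside a word. -/
inductive BraidStep : Word → Word → Prop
  | mk (u v : Word) :
      BraidStep (u ++ [Gen.s, Gen.t, Gen.s] ++ v) (u ++ [Gen.t, Gen.s, Gen.t] ++ v)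

/-- The equivalence relation on words generated by the braid relation. -/
def BraidEquiv : Word → Word → Prop := Relation.EqvGen BraidStep

/-- Conjugacy in `G₄` under the parabolic subgroup `W_J` generated by `J`. -/
def ConjUnder (J : Set Gen) (g h : W) : Prop :=
  ∃ c ∈ Subgroup.closure (refl '' J), c * g * c⁻¹ = h

/-! ### The Hecke algebra -/

/-- The ground ring `R = ℤ[ξ₁, ξ₂]`. -/
abbrev R : Type := MvPolynomial (Fin 2) ℤ

/-- The indeterminate `ξ₁`. -/
noncomputable def ξ₁ : R := MvPolynomial.X 0

/-- The indeterminate `ξ₂`. -/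
noncomputable def ξ₂ : R := MvPolynomial.X 1

/-- The braid relation, and the deformed order relation `T_x³ = 1 + ξ₁ T_x + ξ₂ T_x²`. -/
inductive HeckeRel : FreeAlgebra R Gen → FreeAlgebra R Gen → Prop
  | braid :
      HeckeRel (FreeAlgebra.ι R Gen.s * FreeAlgebra.ι R Gen.t * FreeAlgebra.ι R Gen.s)
        (FreeAlgebra.ι R Gen.t * FreeAlgebra.ι R Gen.s * FreeAlgebra.ι R Gen.t)
  | order (x : Gen) :
      HeckeRel (FreeAlgebra.ι R x ^ 3)
        (1 + ξ₁ • FreeAlgebra.ι R x + ξ₂ • FreeAlgebra.ι R x ^ 2)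

/-- The Hecke algebra `H` of `G₄` over `R = ℤ[ξ₁, ξ₂]`. -/
abbrev H : Type := RingQuot HeckeRel

/-- The generator `T_x` of `H`. -/
noncomputable def gen (x : Gen) : H := RingQuot.mkAlgHom R HeckeRel (FreeAlgebra.ι R x)

/-- `T_w = T_{x₁} ⋯ T_{x_k}` for a word `w = x₁ ⋯ x_k`. -/
noncomputable def T (w : Word) : H := (w.map gen).prod

/-- The parabolic subalgebra `H_J`, generated by the `T_x` with `x ∈ J`. -/
noncomputable def parabolic (J : Set Gen) : Subalgebra R H := Algebra.adjoin R (gen '' J)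

/-- The centralizer `Z_H(H_J)`. -/
noncomputable def parabolicCentralizer (J : Set Gen) : Subalgebra R H :=
  Subalgebra.centralizer R (parabolic J : Set H)

/-! ### Reduced bases -/

/-- `B` is the reduced basis of `H` given by the choice `η` of a reduced word for every element
of `G₄`. -/
def IsReducedBasis (η : W → Word) (B : Module.Basis W R H) : Prop :=
  ∀ g : W, grp (η g) = g ∧ IsReduced (η g) ∧ B g = T (η g)

/-- The coefficient `r_w` of `h` at the basis element that belongs to the group element
represented by the word `w`. -/
noncomputable def coeff (B : Module.Basis W R H) (h : H) (w : Word) : R := B.repr h (grp w)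

open Gen in
/-- The words in the `sts` basis
`B_sts = {T_1, T_s, T_t, T_{s²}, T_{t²}, T_{st}, T_{ts}, T_{st²}, …, T_{s²t²s²}}`. -/
def stsWords : Set Word :=
  {[], [s], [t], [s, s], [t, t], [s, t], [t, s], [s, t, t], [t, t, s], [s, s, t], [t, s, s],
    [s, s, t, t], [t, t, s, s], [s, t, t, s], [t, s, s, t], [s, s, t, s, s], [t, t, s, t, t],
    [s, t, s, t, s, t], [s, t, s], [s, t, s, s], [s, s, t, s], [s, s, t, t, s], [s, t, t, s, s],
    [s, s, t, t, s, s]}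

/-- `M` is a distinguished set for the centralizer of `H_J`, with respect to the reduced basis `B`
given by `η`: it consists of exactly one word `w ∈ η_B(w)` for each `J`-conjugacy class of `G₄`,
and there are `R`-linear relations expressing all other coefficients through those at `M` that
hold for `h` if and only if `h ∈ Z_H(H_J)`. -/
def IsDistinguishedSet (J : Set Gen) (η : W → Word) (B : Module.Basis W R H)
    (M : Finset Word) : Prop :=
  (∀ w ∈ M, BraidEquiv w (η (grp w))) ∧
  (∀ g : W, ∃! w : Word, w ∈ M ∧ ConjUnder J (grp w) g) ∧
  ∃ a : W → Word → R, ∀ h : H, h ∈ parabolicCentralizer J ↔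
    ∀ g : W, (∀ w ∈ M, grp w ≠ g) → B.repr h g = ∑ w ∈ M, a g w * coeff B h w

/-! ### The relations for central elements -/

open Gen in
/-- The relations [C1] to [C14] between the coefficients `r w`. -/
def CentralRelations (r : Word → R) : Prop :=
  -- [C1]
  (r [s, s, t] = r [t, s, s] ∧
    r [t, s, s] = (1 + ξ₁ * ξ₂) * r [t, t, s] + ξ₁ * r [s, s]
      + ξ₁ * (ξ₁ + ξ₂ ^ 2) * r [t, t, s, s]) ∧
  -- [C2]
  r [s, t, s] = r [t, t, s] + ξ₁ * r [t, s] + ξ₁ ^ 2 * r [t, t, s, s] + ξ₁ * r [s, s]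
      - ξ₂ * r [s] ∧
  -- [C3]
  r [t] = r [s] + ξ₁ * r [t, t, s] + ξ₁ * ξ₂ * r [t, t, s, s] ∧
  -- [C4]
  (r [s, s, t, s] = r [s, t, s, s] ∧
    r [s, t, s, s] = r [s] + ξ₁ * (2 + ξ₁ * ξ₂) * r [t, t, s] + ξ₁ ^ 2 * r [s, s]
      + ξ₁ * (ξ₂ + ξ₁ * ξ₂ ^ 2 + ξ₁ ^ 2) * r [t, t, s, s]) ∧
  -- [C5]
  r [s, t, t, s] = r [t, t, s, s] + ξ₁ * r [t, t, s] - ξ₂ * r [s, s] ∧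
  -- [C6]
  r [t, s, s, t] = (1 + 2 * ξ₁ * ξ₂ + ξ₂ ^ 3) * r [t, t, s, s] + ξ₂ * r [s, s]
      + (ξ₁ + ξ₂ ^ 2) * r [t, t, s] ∧
  -- [C7]
  r [s, s, t, s, s] = r [t, s] + ξ₂ * (1 + ξ₁ * ξ₂) * r [t, t, s] + ξ₁ * ξ₂ * r [s, s]
      + ξ₁ * ξ₂ * (ξ₁ + ξ₂ ^ 2) * r [t, t, s, s] ∧
  -- [C8]
  r [t, t, s, t, t] = r [t, s] + ξ₂ * (2 + ξ₁ * ξ₂) * r [t, t, s] + ξ₁ * ξ₂ * r [s, s]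
      + ξ₂ * (ξ₂ + ξ₁ * ξ₂ ^ 2 + ξ₁ ^ 2) * r [t, t, s, s] ∧
  -- [C9]
  (r [s, s, t, t, s] = r [s, t, t, s, s] ∧
    r [s, t, t, s, s] = r [s, s] + ξ₁ * r [t, t, s, s]) ∧
  -- [C10]
  r [t, t] = r [s, s] ∧
  -- [C11]
  r [s, s, t, t, s, s] = r [t, t, s] + ξ₂ * r [t, t, s, s] ∧
  -- [C12]
  r [s, t] = r [t, s] ∧
  -- [C13]
  r [s, t, t] = r [t, t, s] ∧
  -- [C14]
  r [s, s, t, t] = r [t, t, s, s]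

/-- Equality of words is decidable, as needed to form finite sets of words. -/
instance : DecidableEq Gen := fun x y =>
  match x, y with
  | Gen.s, Gen.s => isTrue rfl
  | Gen.t, Gen.t => isTrue rfl
  | Gen.s, Gen.t => isFalse (fun h => Gen.noConfusion h)
  | Gen.t, Gen.s => isFalse (fun h => Gen.noConfusion h)

open Gen in
/-- The set `{1, s, s², ts, t²s, t²s², tststs}`. -/
def centralM : Finset Word :=
  {[], [s], [s, s], [t, s], [t, t, s], [t, t, s, s], [t, s, t, s, t, s]}

end HeckeG4

namespace HeckeG4

/-! The relations rewrite a generator times any of the 24 words, on either side, as a combination of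
these words. The resulting tables `leftS`, `leftT`, `rightS`, `rightT` are derived for every pair
satisfying the relations (`IsHeckePair`), hence apply both in `H` and in the group ring of `G₄`,
where both parameters vanish.

In `H` the left tables show that the 24 words span. Conversely, the left tables themselves satisfy
the Hecke relations on the free module of rank 24; there a combination of words sends the first unit
vector to its own coefficient vector, so the words are independent. In the group ring the left
tables become permutations, and reducedness and conjugacy become finite checks.

Centrality means that left and right multiplication by both generators agree: 48 linear equations in
24 coefficients. `eq_centralVec_of_left_eq_right` solves them without division for 17 coefficients
in terms of the seven at class representatives, and `left_centralVec` shows that those seven are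
free. The relations, the distinguished set and the dual basis all follow. -/

/-- The words of the `sts` basis, in a fixed order. -/
def basisWord : Fin 24 → Word :=
  ![[], [.s], [.t], [.s, .s], [.t, .t], [.s, .t],
    [.t, .s], [.s, .t, .t], [.t, .t, .s], [.s, .s, .t], [.t, .s, .s], [.s, .s, .t, .t],
    [.t, .t, .s, .s], [.s, .t, .t, .s], [.t, .s, .s, .t], [.s, .s, .t, .s, .s],
    [.t, .t, .s, .t, .t], [.s, .t, .s, .t, .s, .t], [.s, .t, .s], [.s, .t, .s, .s], [.s, .s, .t, .s], [.s, .s, .t, .t, .s], [.s, .t, .t, .s, .s],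
    [.s, .s, .t, .t, .s, .s]]

/-! ### Multiplication tables from the cubic Hecke relations -/

section GenericAlgebra

variable {k A : Type*} [CommRing k] [Ring A] [Algebra k A]

/-- The values `f s`, `f t` satisfy the relations of the cubic Hecke algebra on two strands
with parameters `x` and `y`. -/
structure IsHeckePair (x y : k) (f : Gen → A) : Prop where
  braid : f .s * f .t * f .s = f .t * f .s * f .t
  cube (c : Gen) : f c ^ 3 = 1 + x • f c + y • f c ^ 2

/-- The linear combination of the 24 monomials with coefficients `r`. -/
def comb (f : Gen → A) (r : Fin 24 → k) : A :=
  ∑ i, r i • ((basisWord i).map f).prod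

/-- Left multiplication by `T_s` on coefficient vectors. -/
def leftS (x y : k) (r : Fin 24 → k) : Fin 24 → k :=
  ![r 3,
    r 0 + x * r 3,
    r 9,
    r 1 + y * r 3,
    r 11,
    r 2 + x * r 9,
    r 20,
    r 4 + x * r 11,
    r 21,
    r 5 + y * r 9,
    r 15,
    r 7 + y * r 11,
    r 23,
    r 8 + x * r 21,
    r 17,
    y * r 15 + r 19,
    r 14 + x * r 17,
    r 16 + y * r 17,
    r 6 + x * r 20,
    r 10 + x * r 15,
    r 18 + y * r 20,
    r 13 + y * r 21,
    r 12 + x * r 23,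
    r 22 + y * r 23]

/-- Left multiplication by `T_t` on coefficient vectors. -/
def leftT (x y : k) (r : Fin 24 → k) : Fin 24 → k :=
  ![r 4,
    r 8,
    r 0 + x * r 4 + x * r 21 + x * y * r 23,
    r 12,
    r 2 + y * r 4 - x * r 23,
    r 19,
    r 1 + x * r 8 + x^2 * r 21 + (x + x^2 * y) * r 23,
    -x * r 14 + r 16 - y * r 23,
    r 6 + y * r 8 - x * r 11 - x^2 * r 23,
    x * r 14 + r 22,
    r 3 + x * r 11 + x * r 12 + x * y * r 21 + (x * y^2 + x^2) * r 23,
    r 23,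
    r 10 + y * r 12 - x * r 21 - x * y * r 23,
    -y * r 11 - y * r 14 + r 17 - x * y * r 23,
    r 9 + y * r 11 + y * r 14,
    r 13 + x * r 17 + y * r 22,
    y * r 16 + r 20 + y * r 21,
    r 15 + y * r 17 + y * r 23,
    r 5 + x * r 19,
    r 18 + y * r 19,
    r 7 + x * r 16 + x * r 22,
    r 11 + x * r 23,
    r 14 - y * r 21 - y^2 * r 23,
    r 21 + y * r 23]

/-- Right multiplication by `T_s` on coefficient vectors. -/
def rightS (x y : k) (r : Fin 24 → k) : Fin 24 → k :=
  ![r 3,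
    r 0 + x * r 3,
    r 10,
    r 1 + y * r 3,
    r 12,
    r 19,
    r 2 + x * r 10,
    r 22,
    r 4 + x * r 12,
    r 15,
    r 6 + y * r 10,
    r 23,
    r 8 + y * r 12,
    r 7 + x * r 22,
    r 17,
    y * r 15 + r 20,
    r 14 + x * r 17,
    r 16 + y * r 17,
    r 5 + x * r 19,
    r 18 + y * r 19,
    r 9 + x * r 15,
    r 11 + x * r 23,
    r 13 + y * r 22,
    r 21 + y * r 23]

/-- Right multiplication by `T_t` on coefficient vectors. -/
def rightT (x y : k) (r : Fin 24 → k) : Fin 24 → k :=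
  ![r 4,
    r 7,
    r 0 + x * r 4 + x * r 22 + x * y * r 23,
    r 11,
    r 2 + y * r 4 - x * r 23,
    r 1 + x * r 7 + x^2 * r 22 + (x + x^2 * y) * r 23,
    r 20,
    r 5 + y * r 7 - x * r 12 - x^2 * r 23,
    -x * r 14 + r 16 - y * r 23,
    r 3 + x * r 11 + x * r 12 + x * y * r 22 + (x * y^2 + x^2) * r 23,
    x * r 14 + r 21,
    r 9 + y * r 11 - x * r 22 - x * y * r 23,
    r 23,
    -y * r 12 - y * r 14 + r 17 - x * y * r 23,
    r 10 + y * r 12 + y * r 14,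
    r 13 + x * r 17 + y * r 21,
    y * r 16 + r 19 + y * r 22,
    r 15 + y * r 17 + y * r 23,
    r 6 + x * r 20,
    r 8 + x * r 16 + x * r 21,
    r 18 + y * r 20,
    r 14 - y * r 22 - y^2 * r 23,
    r 12 + x * r 23,
    r 22 + y * r 23]

theorem comb_eq (f : Gen → A) (r : Fin 24 → k) : comb f r =
      r 0 • (1 : A) + r 1 • f .s + r 2 • f .t + r 3 • (f .s * f .s)
       + r 4 • (f .t * f .t) + r 5 • (f .s * f .t) + r 6 • (f .t * f .s)
       + r 7 • (f .s * (f .t * f .t)) + r 8 • (f .t * (f .t * f .s))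
       + r 9 • (f .s * (f .s * f .t)) + r 10 • (f .t * (f .s * f .s))
       + r 11 • (f .s * (f .s * (f .t * f .t))) + r 12 • (f .t * (f .t * (f .s * f .s)))
       + r 13 • (f .s * (f .t * (f .t * f .s))) + r 14 • (f .t * (f .s * (f .s * f .t)))
       + r 15 • (f .s * (f .s * (f .t * (f .s * f .s))))
       + r 16 • (f .t * (f .t * (f .s * (f .t * f .t))))
       + r 17 • (f .s * (f .t * (f .s * (f .t * (f .s * f .t)))))
       + r 18 • (f .s * (f .t * f .s)) + r 19 • (f .s * (f .t * (f .s * f .s)))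
       + r 20 • (f .s * (f .s * (f .t * f .s)))
       + r 21 • (f .s * (f .s * (f .t * (f .t * f .s))))
       + r 22 • (f .s * (f .t * (f .t * (f .s * f .s))))
       + r 23 • (f .s * (f .s * (f .t * (f .t * (f .s * f .s))))) := by
  simp only [comb, basisWord, Fin.sum_univ_succ, Fin.sum_univ_zero]
  simp
  abel

/-- With the entries explicit, a combination given by a table expands without index lookups. -/
theorem comb_vec (f : Gen → A) (a0 a1 a2 a3 a4 a5 a6 a7 a8 a9 a10 a11 a12 a13 a14 a15 a16 a17 a18
    a19 a20 a21 a22 a23 : k) :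
    comb f ![a0, a1, a2, a3, a4, a5, a6, a7, a8, a9, a10, a11, a12, a13, a14, a15, a16, a17, a18,
        a19, a20, a21, a22, a23] =
      a0 • (1 : A) + a1 • f .s + a2 • f .t + a3 • (f .s * f .s) + a4 • (f .t * f .t)
       + a5 • (f .s * f .t) + a6 • (f .t * f .s) + a7 • (f .s * (f .t * f .t))
       + a8 • (f .t * (f .t * f .s)) + a9 • (f .s * (f .s * f .t))
       + a10 • (f .t * (f .s * f .s)) + a11 • (f .s * (f .s * (f .t * f .t)))
       + a12 • (f .t * (f .t * (f .s * f .s))) + a13 • (f .s * (f .t * (f .t * f .s)))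
       + a14 • (f .t * (f .s * (f .s * f .t)))
       + a15 • (f .s * (f .s * (f .t * (f .s * f .s))))
       + a16 • (f .t * (f .t * (f .s * (f .t * f .t))))
       + a17 • (f .s * (f .t * (f .s * (f .t * (f .s * f .t)))))
       + a18 • (f .s * (f .t * f .s)) + a19 • (f .s * (f .t * (f .s * f .s)))
       + a20 • (f .s * (f .s * (f .t * f .s)))
       + a21 • (f .s * (f .s * (f .t * (f .t * f .s))))
       + a22 • (f .s * (f .t * (f .t * (f .s * f .s))))
       + a23 • (f .s * (f .s * (f .t * (f .t * (f .s * f .s))))) :=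
  comb_eq f _

namespace IsHeckePair

variable {x y : k} {f : Gen → A}
theorem cube_mul (hf : IsHeckePair x y f) (c : Gen) :
    f c * (f c * f c) = 1 + x • f c + y • (f c * f c) := by
  have h := hf.cube c
  simpa only [pow_succ, pow_zero, one_mul, mul_assoc] using h

theorem cube_mul_assoc (hf : IsHeckePair x y f) (c : Gen) (z : A) :
    f c * (f c * (f c * z)) = z + x • (f c * z) + y • (f c * (f c * z)) := by
  have h := congrArg (· * z) (hf.cube_mul c)
  simpa only [mul_assoc, add_mul, one_mul, smul_mul_assoc] using h

theorem tst (hf : IsHeckePair x y f) : f .t * (f .s * f .t) = f .s * (f .t * f .s) := by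
  have h := hf.braid
  simpa only [mul_assoc] using h.symm

theorem tst_assoc (hf : IsHeckePair x y f) (z : A) :
    f .t * (f .s * (f .t * z)) = f .s * (f .t * (f .s * z)) := by
  have h := congrArg (· * z) hf.tst
  simpa only [mul_assoc] using h

theorem tssts (hf : IsHeckePair x y f) :
    f .t * (f .s * (f .s * (f .t * f .s))) = f .s * (f .t * (f .s * (f .s * f .t))) := by
  rw [← hf.tst, hf.tst_assoc]

theorem tssts_assoc (hf : IsHeckePair x y f) (z : A) :
    f .t * (f .s * (f .s * (f .t * (f .s * z)))) =
      f .s * (f .t * (f .s * (f .s * (f .t * z)))) := by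
  have h := congrArg (· * z) hf.tssts
  simpa only [mul_assoc] using h

/-- The constant term of the cubic relation is 1, so the inverse is a polynomial in the generator.
Below this permits cancelling a generator. -/
theorem isUnit (hf : IsHeckePair x y f) (c : Gen) : IsUnit (f c) := by
  refine isUnit_iff_exists.mpr ⟨f c * f c - y • f c - x • 1, ?_, ?_⟩
  · simp only [mul_sub, mul_smul_comm, hf.cube_mul, mul_one]
    abel
  · simp only [sub_mul, smul_mul_assoc, mul_assoc, hf.cube_mul, one_mul]
    abel

/-- After multiplication by `s` on the left, braid moves turn the word into `tsssts`, where the cube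
can be expanded; `s` is then cancelled. -/
theorem tsstt (hf : IsHeckePair x y f) :
    f .t * (f .s * (f .s * (f .t * f .t))) =
      f .s * (f .s * (f .t * (f .t * f .s))) + y • (f .t * (f .s * (f .s * f .t)))
        - y • (f .s * (f .t * (f .t * f .s))) - x • (f .t * (f .t * f .s))
        + x • (f .t * (f .s * f .s)) := by
  have h : f .s * (f .t * (f .s * (f .s * (f .t * f .t)))) =
      f .t * (f .s * (f .s * (f .s * (f .t * f .s)))) := by
    rw [← hf.tssts_assoc, hf.tst]
  refine (hf.isUnit .s).mul_left_cancel ?_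
  rw [h]
  simp only [mul_add, mul_sub, mul_smul_comm, hf.cube_mul_assoc, hf.tst_assoc, hf.tssts]
  module

/-- Mirror image of `tsstt`, with `s` multiplied and cancelled on the right. -/
theorem ttsst (hf : IsHeckePair x y f) :
    f .t * (f .t * (f .s * (f .s * f .t))) =
      f .s * (f .t * (f .t * (f .s * f .s))) + y • (f .t * (f .s * (f .s * f .t)))
        - y • (f .s * (f .t * (f .t * f .s))) - x • (f .s * (f .t * f .t))
        + x • (f .s * (f .s * f .t)) := by
  have h : f .t * (f .t * (f .s * (f .s * (f .t * f .s)))) =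
      f .s * (f .t * (f .s * (f .s * (f .s * f .t)))) := by
    rw [hf.tssts, hf.tst_assoc]
  refine (hf.isUnit .s).mul_right_cancel ?_
  simp only [mul_assoc, add_mul, sub_mul, smul_mul_assoc]
  rw [h]
  simp only [mul_add, mul_smul_comm, hf.cube_mul_assoc, hf.cube_mul, mul_one, hf.tst, hf.tssts]
  module

theorem tsstt_assoc (hf : IsHeckePair x y f) (z : A) :
    f .t * (f .s * (f .s * (f .t * (f .t * z)))) =
      f .s * (f .s * (f .t * (f .t * (f .s * z)))) + y • (f .t * (f .s * (f .s * (f .t * z))))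
        - y • (f .s * (f .t * (f .t * (f .s * z)))) - x • (f .t * (f .t * (f .s * z)))
        + x • (f .t * (f .s * (f .s * z))) := by
  have h := congrArg (· * z) hf.tsstt
  simpa only [mul_assoc, add_mul, sub_mul, smul_mul_assoc] using h

theorem mul_comb_s (hf : IsHeckePair x y f) (r : Fin 24 → k) :
    f .s * comb f r = comb f (leftS x y r) := by
  rw [leftS, comb_vec, comb_eq]
  simp only [mul_add, smul_add, mul_smul_comm, mul_one, hf.cube_mul, hf.cube_mul_assoc, hf.tst,
    hf.tst_assoc, hf.tssts]
  module

theorem mul_comb_t (hf : IsHeckePair x y f) (r : Fin 24 → k) :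
    f .t * comb f r = comb f (leftT x y r) := by
  rw [leftT, comb_vec, comb_eq]
  simp only [mul_add, add_mul, smul_add, smul_sub, mul_smul_comm, mul_assoc, mul_one,
    hf.cube_mul, hf.cube_mul_assoc, hf.tst, hf.tst_assoc, hf.tssts, hf.tssts_assoc, hf.tsstt,
    hf.tsstt_assoc, hf.ttsst]
  module

theorem comb_mul_s (hf : IsHeckePair x y f) (r : Fin 24 → k) :
    comb f r * f .s = comb f (rightS x y r) := by
  rw [rightS, comb_vec, comb_eq]
  simp only [mul_add, add_mul, smul_add, mul_smul_comm, smul_mul_assoc, mul_assoc, mul_one,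
    one_mul, hf.cube_mul, hf.cube_mul_assoc, hf.tst, hf.tst_assoc, hf.tssts]
  module

theorem comb_mul_t (hf : IsHeckePair x y f) (r : Fin 24 → k) :
    comb f r * f .t = comb f (rightT x y r) := by
  rw [rightT, comb_vec, comb_eq]
  simp only [mul_add, add_mul, mul_sub, smul_add, smul_sub, mul_smul_comm, smul_mul_assoc,
    mul_assoc, mul_one, one_mul, hf.cube_mul, hf.cube_mul_assoc, hf.tst, hf.tst_assoc, hf.tssts,
    hf.tsstt, hf.ttsst]
  module
end IsHeckePair
end GenericAlgebra

/-! ### The group: 24 elements and reduced words -/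

/-- The permutation of the indices of the words that a generator induces by left
multiplication in `G₄`. -/
def act : Gen → Fin 24 → Fin 24
  | .s => ![1, 3, 5, 0, 7, 9, 18, 11, 13, 2, 19, 4, 22, 21, 16, 10, 17, 14, 20, 15, 6, 8, 23, 12]
  | .t => ![2, 6, 4, 10, 0, 18, 8, 20, 1, 14, 12, 21, 3, 15, 22, 17, 7, 13, 19, 5, 16, 23, 9, 11]

/-- The permutation `act c`. -/
def actPerm (c : Gen) : Equiv.Perm (Fin 24) where
  toFun := act c
  -- `act c` has order three, so its square is its inverse.
  invFun := act c ∘ act c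
  left_inv := by cases c <;> decide
  right_inv := by cases c <;> decide

/-- The left regular representation of `G₄` on indices of words. -/
def regularPerm : W →* Equiv.Perm (Fin 24) :=
  PresentedGroup.toGroup (rels := relators) (f := actPerm) (by
    rintro r (rfl | rfl | rfl) <;>
      simp only [map_mul, map_pow, map_inv, FreeGroup.lift_apply_of] <;> decide)

theorem regularPerm_refl (c : Gen) : regularPerm (refl c) = actPerm c :=
  PresentedGroup.toGroup.of _

theorem refl_cube (c : Gen) : refl c * (refl c * refl c) = 1 := by
  have h : PresentedGroup.mk relators (FreeGroup.of c ^ 3) = 1 :=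
    PresentedGroup.one_of_mem (by cases c <;> simp [relators])
  rw [← h, map_pow, pow_succ, pow_two, mul_assoc]
  rfl

theorem refl_braid : refl .s * refl .t * refl .s = refl .t * refl .s * refl .t := by
  have h : PresentedGroup.mk relators (FreeGroup.of Gen.s * FreeGroup.of Gen.t * FreeGroup.of
      Gen.s *
      (FreeGroup.of Gen.t * FreeGroup.of Gen.s * FreeGroup.of Gen.t)⁻¹) = 1 :=
    PresentedGroup.one_of_mem (by simp [relators])
  rw [map_mul, map_inv, mul_inv_eq_one] at h
  simp only [map_mul] at h
  exact h

/-- The group elements, inside the group ring, satisfy the relations with both parameters zero. -/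
theorem isHeckePair_groupRing :
    IsHeckePair (0 : ℤ) 0 (fun c => MonoidAlgebra.of ℤ W (refl c)) where
  braid := by simp only [← map_mul, refl_braid]
  cube c := by
    simp only [zero_smul, add_zero, ← map_pow]
    rw [pow_succ, pow_two, mul_assoc, refl_cube, map_one]

theorem comb_single {k A : Type*} [CommRing k] [Ring A] [Algebra k A] (f : Gen → A) (i : Fin 24) :
    comb f (Pi.single i (1 : k)) = ((basisWord i).map f).prod := by
  simp [comb, Pi.single_apply]

/-- At zero parameters the deformation terms vanish and the left tables permute the unit vectors. -/
theorem left_single (i : Fin 24) :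
    leftS (0 : ℤ) 0 (Pi.single i 1) = Pi.single (act .s i) 1 ∧
      leftT (0 : ℤ) 0 (Pi.single i 1) = Pi.single (act .t i) 1 := by
  revert i
  decide +kernel

/-- The Hecke computation is reused in the group ring, into which the group embeds. -/
theorem refl_mul_grp_basisWord (c : Gen) (i : Fin 24) :
    refl c * grp (basisWord i) = grp (basisWord (act c i)) := by
  have key (w : Word) : (w.map fun c => MonoidAlgebra.of ℤ W (refl c)).prod =
      MonoidAlgebra.of ℤ W (grp w) := by
    rw [grp, map_list_prod, List.map_map]
    rfl
  apply MonoidAlgebra.of_injective (R := ℤ)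
  rw [map_mul, ← key, ← key, ← comb_single (k := ℤ), ← comb_single (k := ℤ)]
  cases c
  · rw [← (left_single i).1]
    exact isHeckePair_groupRing.mul_comb_s _
  · rw [← (left_single i).2]
    exact isHeckePair_groupRing.mul_comb_t _

theorem grp_cons (c : Gen) (w : Word) : grp (c :: w) = refl c * grp w := by
  simp [grp]

/-- The index of the word obtained by letting `w` act on the word with index `i`. -/
def wordAct (w : Word) (i : Fin 24) : Fin 24 := w.foldr act i

theorem regularPerm_grp (w : Word) (i : Fin 24) : regularPerm (grp w) i = wordAct w i := by
  induction w with
  | nil => simp [grp, wordAct]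
  | cons c w ih =>
    rw [grp_cons, map_mul, Equiv.Perm.mul_apply, ih, regularPerm_refl]
    rfl

theorem grp_mul_grp_basisWord (w : Word) (i : Fin 24) :
    grp w * grp (basisWord i) = grp (basisWord (wordAct w i)) := by
  induction w with
  | nil => simp [grp, wordAct]
  | cons c w ih =>
    rw [grp_cons, mul_assoc, ih, refl_mul_grp_basisWord]
    rfl

theorem wordAct_basisWord (i : Fin 24) : wordAct (basisWord i) 0 = i := by
  revert i
  decide

theorem grp_eq_grp_basisWord (w : Word) : grp w = grp (basisWord (wordAct w 0)) := by
  rw [← grp_mul_grp_basisWord]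
  simp [basisWord, grp]

theorem exists_grp_eq (g : W) : ∃ w : Word, grp w = g := by
  have hg : g ∈ Subgroup.closure (Set.range refl) := by
    rw [show Set.range refl = Set.range (PresentedGroup.of (rels := relators)) from rfl,
      PresentedGroup.closure_range_of]
    trivial
  induction hg using Subgroup.closure_induction_left with
  | one => exact ⟨[], rfl⟩
  | mul_left x hx y _ ih =>
    obtain ⟨c, rfl⟩ := hx
    obtain ⟨w, rfl⟩ := ih
    exact ⟨c :: w, grp_cons c w⟩
  | inv_mul_cancel x hx y _ ih =>
    obtain ⟨c, rfl⟩ := hx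
    obtain ⟨w, rfl⟩ := ih
    -- The inverse of a generator is its square, so positive words suffice.
    refine ⟨c :: c :: w, ?_⟩
    rw [grp_cons, grp_cons, eq_inv_mul_iff_mul_eq, ← mul_assoc, ← mul_assoc, mul_assoc (refl c),
      refl_cube, one_mul]

/-- The words of the `sts` basis represent every element of `G₄` exactly once. -/
def groupEquiv : W ≃ Fin 24 where
  toFun g := regularPerm g 0
  invFun i := grp (basisWord i)
  left_inv g := by
    obtain ⟨w, rfl⟩ := exists_grp_eq g
    dsimp only
    rw [regularPerm_grp, ← grp_eq_grp_basisWord]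
  right_inv i := by
    dsimp only
    rw [regularPerm_grp, wordAct_basisWord]

@[simp]
theorem groupEquiv_grp (w : Word) : groupEquiv (grp w) = wordAct w 0 :=
  regularPerm_grp w 0

@[simp]
theorem groupEquiv_symm_apply (i : Fin 24) : groupEquiv.symm i = grp (basisWord i) := rfl

/-- Prefixing a letter lengthens the chosen word by at most one; by induction no word is shorter
than the chosen word for its element. -/
theorem length_basisWord_act_le (c : Gen) (i : Fin 24) :
    (basisWord (act c i)).length ≤ (basisWord i).length + 1 := by
  revert i
  cases c <;> decide

theorem length_basisWord_wordAct_le (w : Word) : (basisWord (wordAct w 0)).length ≤ w.length := by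
  induction w with
  | nil => decide
  | cons c w ih =>
    exact (length_basisWord_act_le c _).trans (Nat.succ_le_succ ih)

theorem isReduced_basisWord (i : Fin 24) : IsReduced (basisWord i) := by
  intro v hv
  have h := congrArg groupEquiv hv
  rw [groupEquiv_grp, groupEquiv_grp, wordAct_basisWord] at h
  exact h ▸ length_basisWord_wordAct_le v

theorem range_basisWord : Set.range basisWord = stsWords := by
  simp only [basisWord, Matrix.range_cons, Matrix.range_empty, Set.singleton_union,
    Set.union_empty, stsWords]

/-! ### Conjugacy classes -/

/-- The representatives of the conjugacy classes. -/
def classWord : Fin 7 → Word :=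
  ![[], [.s], [.s, .s], [.t, .s], [.t, .t, .s], [.t, .t, .s, .s], [.t, .s, .t, .s, .t, .s]]

/-- Writing conjugacy as `c * g = h * c` removes the inverse and leaves a decidable statement about
indices. -/
theorem conjUnder_univ_iff (i j : Fin 24) :
    ConjUnder Set.univ (grp (basisWord i)) (grp (basisWord j)) ↔
      ∃ c, wordAct (basisWord c) i = wordAct (basisWord j) c := by
  have hcl : Subgroup.closure (refl '' Set.univ) = ⊤ := by
    rw [Set.image_univ]
    exact PresentedGroup.closure_range_of _
  have hiff (c : Fin 24) : grp (basisWord c) * grp (basisWord i) * (grp (basisWord c))⁻¹ =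
      grp (basisWord j) ↔ wordAct (basisWord c) i = wordAct (basisWord j) c := by
    rw [mul_inv_eq_iff_eq_mul, grp_mul_grp_basisWord, grp_mul_grp_basisWord]
    exact groupEquiv.symm.injective.eq_iff
  simp only [ConjUnder, hcl, Subgroup.mem_top, true_and, ← hiff]
  exact groupEquiv.symm.surjective.exists

theorem existsUnique_conj (j : Fin 24) : ∃! i : Fin 7, ∃ c,
    wordAct (basisWord c) (wordAct (classWord i) 0) = wordAct (basisWord j) c := by
  simp only [ExistsUnique]
  revert j
  decide +kernel

/-! ### The regular representation -/

section RegularRepresentation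

variable {k : Type*} [CommRing k] (x y : k)

/-- The regular representation on coefficient vectors. -/
def leftMap : Gen → Module.End k (Fin 24 → k)
  | .s =>
    { toFun := leftS x y
      map_add' := fun u v => by
        ext i
        fin_cases i <;>
    simp only [leftS, Pi.add_apply, Fin.reduceFinMk, Fin.zero_eta, Fin.mk_one, Fin.isValue,
      Matrix.cons_val] <;>
    ring
      map_smul' := fun c v => by
        ext i
        fin_cases i <;>
    simp only [leftS, Pi.smul_apply, smul_eq_mul, Fin.reduceFinMk, Fin.zero_eta, Fin.mk_one,
      Fin.isValue, Matrix.cons_val, RingHom.id_apply] <;>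
    ring }
  | .t =>
    { toFun := leftT x y
      map_add' := fun u v => by
        ext i
        fin_cases i <;>
    simp only [leftT, Pi.add_apply, Fin.reduceFinMk, Fin.zero_eta, Fin.mk_one, Fin.isValue,
      Matrix.cons_val] <;>
    ring
      map_smul' := fun c v => by
        ext i
        fin_cases i <;>
    simp only [leftT, Pi.smul_apply, smul_eq_mul, Fin.reduceFinMk, Fin.zero_eta, Fin.mk_one,
      Fin.isValue, Matrix.cons_val, RingHom.id_apply] <;>
    ring }

theorem leftS_cube (r : Fin 24 → k) : leftS x y (leftS x y (leftS x y r)) =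
    r + x • leftS x y r + y • leftS x y (leftS x y r) := by
  ext i
  fin_cases i <;>
    simp only [leftS, Pi.add_apply, Pi.smul_apply, smul_eq_mul, Fin.reduceFinMk, Fin.zero_eta,
      Fin.mk_one, Fin.isValue, Matrix.cons_val] <;>
    ring

theorem leftT_cube (r : Fin 24 → k) : leftT x y (leftT x y (leftT x y r)) =
    r + x • leftT x y r + y • leftT x y (leftT x y r) := by
  ext i
  fin_cases i <;>
    simp only [leftT, Pi.add_apply, Pi.smul_apply, smul_eq_mul, Fin.reduceFinMk, Fin.zero_eta,
      Fin.mk_one, Fin.isValue, Matrix.cons_val] <;>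
    ring

theorem left_braid (r : Fin 24 → k) : leftS x y (leftT x y (leftS x y r)) =
    leftT x y (leftS x y (leftT x y r)) := by
  ext i
  fin_cases i <;>
    simp only [leftT, leftS, Fin.reduceFinMk, Fin.zero_eta, Fin.mk_one, Fin.isValue,
      Matrix.cons_val] <;>
    ring

theorem leftMap_s (r : Fin 24 → k) : leftMap x y .s r = leftS x y r := rfl

theorem leftMap_t (r : Fin 24 → k) : leftMap x y .t r = leftT x y r := rfl

theorem isHeckePair_leftMap : IsHeckePair x y (leftMap x y) where
  braid := LinearMap.ext fun r => by
    simp only [Module.End.mul_apply, leftMap_s, leftMap_t, left_braid]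
  cube c := LinearMap.ext fun r => by
    simp only [pow_succ, pow_zero, one_mul, LinearMap.add_apply, LinearMap.smul_apply,
      Module.End.mul_apply, Module.End.one_apply]
    cases c
    · simp only [leftMap_s, leftS_cube]
    · simp only [leftMap_t, leftT_cube]

/-- The vector is the coordinate vector of 1. Recovering `r` from the action on it is what makes the
words independent. -/
theorem comb_leftMap_apply (r : Fin 24 → k) :
    comb (leftMap x y) r ![1, 0, 0, 0, 0, 0, 0, 0, 0, 0, 0, 0, 0, 0, 0, 0, 0, 0, 0, 0, 0, 0, 0, 0] =
      r := by
  rw [comb_eq]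
  simp only [LinearMap.add_apply, LinearMap.smul_apply, Module.End.mul_apply, Module.End.one_apply,
    leftMap_s, leftMap_t, leftS, leftT, Matrix.cons_val, mul_zero, add_zero, zero_add, sub_zero]
  ext i
  fin_cases i <;>
    simp only [Pi.add_apply, Pi.smul_apply, smul_eq_mul, Fin.reduceFinMk, Fin.zero_eta, Fin.mk_one,
      Matrix.cons_val, mul_zero, add_zero, zero_add, mul_one]

end RegularRepresentation

/-! ### The `sts` basis of the Hecke algebra -/

theorem isHeckePair_gen : IsHeckePair ξ₁ ξ₂ gen where
  braid := by
    have h := RingQuot.mkAlgHom_rel R HeckeRel.braid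
    simp only [map_mul] at h
    exact h
  cube c := by
    have h := RingQuot.mkAlgHom_rel R (HeckeRel.order c)
    simp only [map_pow, map_add, map_one, map_smul] at h
    exact h

/-- The regular representation of the Hecke algebra on coefficient vectors. -/
noncomputable def regularRep : H →ₐ[R] Module.End R (Fin 24 → R) :=
  RingQuot.liftAlgHom R ⟨FreeAlgebra.lift R (leftMap ξ₁ ξ₂), by
    intro a b hab
    induction hab with
    | braid => simpa using (isHeckePair_leftMap ξ₁ ξ₂).braid
    | order c => simpa using (isHeckePair_leftMap ξ₁ ξ₂).cube c⟩

theorem regularRep_gen (c : Gen) : regularRep (gen c) = leftMap ξ₁ ξ₂ c := by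
  simp [regularRep, gen]

theorem map_comb {k A B : Type*} [CommRing k] [Ring A] [Algebra k A] [Ring B] [Algebra k B]
    (φ : A →ₐ[k] B) (f : Gen → A) (r : Fin 24 → k) : φ (comb f r) = comb (fun c => φ (f c)) r := by
  simp only [comb, map_sum, map_smul, map_list_prod, List.map_map]
  rfl

theorem comb_add {k A : Type*} [CommRing k] [Ring A] [Algebra k A] (f : Gen → A)
    (u v : Fin 24 → k) : comb f (u + v) = comb f u + comb f v := by
  simp only [comb, Pi.add_apply, add_smul, Finset.sum_add_distrib]

theorem comb_gen_injective : Function.Injective (comb gen : (Fin 24 → R) → H) := by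
  intro u v huv
  have key (r : Fin 24 → R) : regularRep (comb gen r) = comb (leftMap ξ₁ ξ₂) r :=
    (map_comb regularRep gen r).trans (by rw [funext regularRep_gen])
  rw [← comb_leftMap_apply ξ₁ ξ₂ u, ← comb_leftMap_apply ξ₁ ξ₂ v, ← key, ← key, huv]

theorem linearIndependent_T : LinearIndependent R fun i => T (basisWord i) := by
  rw [Fintype.linearIndependent_iffₛ]
  intro u v huv i
  have h : comb gen u = comb gen v := huv
  exact congrFun (comb_gen_injective h) i

theorem adjoin_range_gen : Algebra.adjoin R (Set.range gen) = ⊤ := by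
  have h : Set.range gen = RingQuot.mkAlgHom R HeckeRel '' Set.range (FreeAlgebra.ι R) := by
    rw [← Set.range_comp]
    rfl
  rw [h, ← AlgHom.map_adjoin, FreeAlgebra.adjoin_range_ι, Algebra.map_top, AlgHom.range_eq_top]
  exact RingQuot.mkAlgHom_surjective R HeckeRel

/-- The combinations of words are stable under left multiplication by the generators, hence by all
of `H`, and they include 1. -/
theorem exists_comb_eq (h : H) : ∃ r : Fin 24 → R, comb gen r = h := by
  have key : ∀ (c : Gen) (r : Fin 24 → R), ∃ r' : Fin 24 → R, gen c * comb gen r = comb gen r' := by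
    rintro (_ | _) r
    · exact ⟨_, isHeckePair_gen.mul_comb_s r⟩
    · exact ⟨_, isHeckePair_gen.mul_comb_t r⟩
  have hmul : ∀ a : H, a ∈ Algebra.adjoin R (Set.range gen) → ∀ r : Fin 24 → R,
      ∃ r' : Fin 24 → R, a * comb gen r = comb gen r' := by
    intro a ha
    induction ha using Algebra.adjoin_induction with
    | mem a ha =>
      obtain ⟨c, rfl⟩ := ha
      exact key c
    | algebraMap a =>
      intro r
      refine ⟨a • r, ?_⟩
      simp [comb, ← Algebra.smul_def, Finset.smul_sum, smul_smul]
    | add a b _ _ iha ihb =>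
      intro r
      obtain ⟨u, hu⟩ := iha r
      obtain ⟨v, hv⟩ := ihb r
      refine ⟨u + v, ?_⟩
      rw [add_mul, hu, hv, comb_add]
    | mul a b _ _ iha ihb =>
      intro r
      obtain ⟨v, hv⟩ := ihb r
      obtain ⟨u, hu⟩ := iha v
      exact ⟨u, by rw [mul_assoc, hv, hu]⟩
  obtain ⟨r, hr⟩ := hmul h (adjoin_range_gen ▸ Algebra.mem_top) (Pi.single 0 1)
  refine ⟨r, ?_⟩
  rw [← hr, comb_single]
  simp [basisWord]

/-- The `sts` basis, with basis elements indexed by `Fin 24`. -/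
noncomputable def finBasis : Module.Basis (Fin 24) R H :=
  Module.Basis.mk linearIndependent_T (by
    intro h _
    obtain ⟨r, rfl⟩ := exists_comb_eq h
    exact Submodule.sum_mem _ fun i _ => Submodule.smul_mem _ _ (Submodule.subset_span ⟨i, rfl⟩))

theorem comb_eq_finBasis (r : Fin 24 → R) : comb gen r = finBasis.equivFun.symm r := by
  rw [Module.Basis.equivFun_symm_apply]
  simp [finBasis, comb, T]

/-- The `sts` basis, with basis elements indexed by the group. -/
noncomputable def stsBasis : Module.Basis W R H := finBasis.reindex groupEquiv.symm

/-- The reduced words of the `sts` basis. -/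
def stsWord (g : W) : Word := basisWord (groupEquiv g)

theorem stsBasis_repr_grp (r : Fin 24 → R) (w : Word) :
    stsBasis.repr (comb gen r) (grp w) = r (wordAct w 0) := by
  rw [comb_eq_finBasis]
  simp [stsBasis, Module.Basis.equivFun]

theorem isReducedBasis_stsBasis : IsReducedBasis stsWord stsBasis := by
  intro g
  refine ⟨groupEquiv.symm_apply_apply g, isReduced_basisWord _, ?_⟩
  simp [stsBasis, stsWord, finBasis]

theorem range_stsWord : Set.range stsWord = stsWords :=
  (groupEquiv.surjective.range_comp basisWord).trans range_basisWord

/-! ### The centre as the solution space of a linear system -/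

/-- An element commutes with everything if it commutes with both generators. -/
theorem mem_center_iff (r : Fin 24 → R) : comb gen r ∈ Subalgebra.center R H ↔
    leftS ξ₁ ξ₂ r = rightS ξ₁ ξ₂ r ∧ leftT ξ₁ ξ₂ r = rightT ξ₁ ξ₂ r := by
  rw [← comb_gen_injective.eq_iff, ← comb_gen_injective.eq_iff, ← isHeckePair_gen.mul_comb_s,
    ← isHeckePair_gen.mul_comb_t, ← isHeckePair_gen.comb_mul_s, ← isHeckePair_gen.comb_mul_t,
    Subalgebra.mem_center_iff]
  constructor
  · exact fun h => ⟨h _, h _⟩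
  · rintro ⟨hs, ht⟩ a
    -- The centralizer of an element is a subalgebra, so it is everything once it contains the
    -- generators.
    have hle : Algebra.adjoin R (Set.range gen) ≤ Subalgebra.centralizer R {comb gen r} := by
      refine Algebra.adjoin_le ?_
      rintro _ ⟨_ | _, rfl⟩
      · exact (Subalgebra.mem_centralizer_iff R).mpr fun _ hb => hb ▸ hs.symm
      · exact (Subalgebra.mem_centralizer_iff R).mpr fun _ hb => hb ▸ ht.symm
    rw [adjoin_range_gen] at hle
    exact ((Subalgebra.mem_centralizer_iff R).mp (hle Algebra.mem_top) _ rfl).symm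

theorem parabolicCentralizer_univ :
    parabolicCentralizer Set.univ = Subalgebra.center R H := by
  rw [parabolicCentralizer, parabolic, Set.image_univ, adjoin_range_gen, Algebra.coe_top,
    Subalgebra.centralizer_univ]

/-- The indices of the representatives of the conjugacy classes. -/
def classIndex : Fin 7 → Fin 24 := ![0, 1, 3, 6, 8, 12, 17]

section Centre

variable {k : Type*} [CommRing k] (x y : k)

/-- The coefficient vector of the central element with given coefficients at the representatives
of the conjugacy classes. -/
def centralVec (c : Fin 7 → k) : Fin 24 → k :=
  ![c 0,
    c 1,
    c 1 + x * c 4 + x * y * c 5,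
    c 2,
    c 2,
    c 3,
    c 3,
    c 4,
    c 4,
    (1 + x * y) * c 4 + x * c 2 + x * (x + y^2) * c 5,
    (1 + x * y) * c 4 + x * c 2 + x * (x + y^2) * c 5,
    c 5,
    c 5,
    c 5 + x * c 4 - y * c 2,
    (1 + 2 * x * y + y^3) * c 5 + y * c 2 + (x + y^2) * c 4,
    c 3 + y * (1 + x * y) * c 4 + x * y * c 2 + x * y * (x + y^2) * c 5,
    c 3 + y * (2 + x * y) * c 4 + x * y * c 2 + y * (y + x * y^2 + x^2) * c 5,
    c 6,
    c 4 + x * c 3 + x^2 * c 5 + x * c 2 - y * c 1,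
    c 1 + x * (2 + x * y) * c 4 + x^2 * c 2 + x * (y + x * y^2 + x^2) * c 5,
    c 1 + x * (2 + x * y) * c 4 + x^2 * c 2 + x * (y + x * y^2 + x^2) * c 5,
    c 2 + x * c 5,
    c 2 + x * c 5,
    c 4 + y * c 5]

theorem centralVec_classIndex (c : Fin 7 → k) (j : Fin 7) :
    centralVec x y c (classIndex j) = c j := by
  fin_cases j <;> rfl

theorem left_centralVec (c : Fin 7 → k) :
    leftS x y (centralVec x y c) = rightS x y (centralVec x y c) ∧
      leftT x y (centralVec x y c) = rightT x y (centralVec x y c) := by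
  constructor <;> ext i <;> fin_cases i <;>
    simp only [leftS, leftT, rightS, rightT, centralVec, Fin.reduceFinMk, Fin.zero_eta, Fin.mk_one,
      Fin.isValue, Matrix.cons_val] <;>
    ring

/-- Of the 48 equations the 17 extracted here suffice, one for each coefficient to be eliminated.
The multipliers are polynomials in `x` and `y`, so nothing is inverted. -/
theorem eq_centralVec_of_left_eq_right (r : Fin 24 → k) (hs : leftS x y r = rightS x y r)
    (ht : leftT x y r = rightT x y r) : r = centralVec x y (fun j => r (classIndex j)) := by
  have s2 := congrFun hs 2
  have s4 := congrFun hs 4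
  have s6 := congrFun hs 6
  have s7 := congrFun hs 7
  have s10 := congrFun hs 10
  have s12 := congrFun hs 12
  have s15 := congrFun hs 15
  have s18 := congrFun hs 18
  have s22 := congrFun hs 22
  have s23 := congrFun hs 23
  have t1 := congrFun ht 1
  have t6 := congrFun ht 6
  have t8 := congrFun ht 8
  have t9 := congrFun ht 9
  have t12 := congrFun ht 12
  have t20 := congrFun ht 20
  have t21 := congrFun ht 21
  simp only [leftS, leftT, rightS, rightT, Fin.isValue,
      Matrix.cons_val] at s2 s4 s6 s7 s10 s12 s15 s18 s22 s23 t1 t6 t8 t9 t12 t20 t21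
  ext i
  fin_cases i <;>
    simp only [centralVec, classIndex, Fin.reduceFinMk, Fin.zero_eta, Fin.mk_one, Fin.isValue,
      Matrix.cons_val]
  · linear_combination -s6 - t6 - x * t12
  · linear_combination -x * s4 + s7 + t9 + x * t21
  · linear_combination -x * s15 - s18
  · linear_combination -t1
  · linear_combination s2 + (1 + x * y) * s12 - x * s23 + x * t9 + t12 + x^2 * t21
  · linear_combination (1 + x * y) * s12 - x * s23 + x * t9 + t12 + x^2 * t21
  · linear_combination s4
  · linear_combination x * s12 - s22 - y * t9 - x * y * t21
  · linear_combination s4 + (y^2 + x) * s12 + y * t9 + (- 1 + x * y) * t21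
  · linear_combination s10 + (y + x * y^2) * s12 - x * y * s23 + x * y * t9 + y * t12 +
      x^2 * y * t21
  · linear_combination (y + x * y^2) * s12 - t8 + x * y * t9 + (- x + x^2 * y) * t21
  · linear_combination x^2 * y * s23 - t1 + y * t6 - x * t8 + x * t9 - t20
  · linear_combination (x + x^2 * y) * s12 + s15 - x^2 * s23 - t6 + x^2 * t9 + x^3 * t21
  · linear_combination (x + x^2 * y) * s12 - x^2 * s23 - t6 + x^2 * t9 + x^3 * t21
  · linear_combination -s23 + t9 + x * t21
  · linear_combination t9 + x * t21
  · linear_combination s12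

theorem left_eq_right_iff (r : Fin 24 → k) :
    leftS x y r = rightS x y r ∧ leftT x y r = rightT x y r ↔
      r = centralVec x y (fun j => r (classIndex j)) := by
  refine ⟨fun h => eq_centralVec_of_left_eq_right x y r h.1 h.2, fun h => ?_⟩
  rw [h]
  exact left_centralVec x y _

/-- `centralVec` is linear in `c`; its values at unit vectors are the coefficients required of a
distinguished set. -/
theorem sum_centralVec_single (c : Fin 7 → k) (i : Fin 24) :
    ∑ j, centralVec x y (fun l => if l = j then 1 else 0) i * c j = centralVec x y c i := by
  fin_cases i <;>
    simp [Fin.sum_univ_seven, centralVec] <;>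
    ring

end Centre

theorem comb_mem_center_iff (r : Fin 24 → R) : comb gen r ∈ Subalgebra.center R H ↔
    r = centralVec ξ₁ ξ₂ (fun j => r (classIndex j)) :=
  (mem_center_iff r).trans (left_eq_right_iff ξ₁ ξ₂ r)

theorem coeff_comb (r : Fin 24 → R) (w : Word) :
    coeff stsBasis (comb gen r) w = r (wordAct w 0) :=
  stsBasis_repr_grp r w

/-- [C1], [C4] and [C9] contain two equations each, so there are 17, one for each entry of
`centralVec` away from the representatives. -/
theorem centralRelations_iff (r : Fin 24 → R) :
    CentralRelations (fun w => r (wordAct w 0)) ↔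
      r = centralVec ξ₁ ξ₂ (fun j => r (classIndex j)) := by
  simp only [CentralRelations, wordAct, List.foldr, act, Fin.isValue, Matrix.cons_val]
  constructor
  · rintro ⟨⟨h1, h1'⟩, h2, h3, ⟨h4, h4'⟩, h5, h6, h7, h8, ⟨h9, h9'⟩, h10, h11, h12, h13, h14⟩
    ext i : 1
    fin_cases i <;>
      simp only [centralVec, classIndex, Fin.reduceFinMk, Fin.zero_eta, Fin.mk_one, Fin.isValue,
        Matrix.cons_val]
    · linear_combination h3
    · linear_combination h10
    · linear_combination h12
    · linear_combination h13
    · linear_combination h1 + h1'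
    · linear_combination h1'
    · linear_combination h14
    · linear_combination h5
    · linear_combination h6
    · linear_combination h7
    · linear_combination h8
    · linear_combination h2
    · linear_combination h4'
    · linear_combination h4 + h4'
    · linear_combination h9 + h9'
    · linear_combination h9'
    · linear_combination h11
  · intro h
    have h2 := congrFun h 2
    have h4 := congrFun h 4
    have h5 := congrFun h 5
    have h7 := congrFun h 7
    have h9 := congrFun h 9
    have h10 := congrFun h 10
    have h11 := congrFun h 11
    have h13 := congrFun h 13
    have h14 := congrFun h 14
    have h15 := congrFun h 15
    have h16 := congrFun h 16
    have h18 := congrFun h 18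
    have h19 := congrFun h 19
    have h20 := congrFun h 20
    have h21 := congrFun h 21
    have h22 := congrFun h 22
    have h23 := congrFun h 23
    simp only [centralVec, classIndex, Fin.isValue,
        Matrix.cons_val] at h2 h4 h5 h7 h9 h10 h11 h13 h14 h15 h16 h18 h19 h20 h21 h22 h23
    exact ⟨⟨by linear_combination h9 - h10, by linear_combination h10⟩,
      by linear_combination h18,
      by linear_combination h2,
      ⟨by linear_combination h20 - h19, by linear_combination h19⟩,
      by linear_combination h13,
      by linear_combination h14,
      by linear_combination h15,
      by linear_combination h16,
      ⟨by linear_combination h21 - h22, by linear_combination h22⟩,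
      by linear_combination h4,
      by linear_combination h23,
      by linear_combination h5,
      by linear_combination h7,
      by linear_combination h11⟩

theorem mem_center_iff_centralRelations (h : H) :
    h ∈ Subalgebra.center R H ↔ CentralRelations (coeff stsBasis h) := by
  obtain ⟨r, rfl⟩ := exists_comb_eq h
  rw [comb_mem_center_iff, ← centralRelations_iff, funext (coeff_comb r)]

/-! ### The distinguished set and the basis of the centre -/

theorem centralM_eq_image : centralM = Finset.univ.image classWord := by
  decide

theorem classWord_injective : Function.Injective classWord := by
  decide

theorem wordAct_classWord (j : Fin 7) : wordAct (classWord j) 0 = classIndex j := by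
  revert j
  decide

theorem braidEquiv_classWord (j : Fin 7) :
    BraidEquiv (classWord j) (basisWord (classIndex j)) := by
  -- Only this representative differs from its basis word: `tst·sts` becomes `sts·sts`, then
  -- `sts·tst`.
  have h : BraidEquiv [.t, .s, .t, .s, .t, .s] [.s, .t, .s, .t, .s, .t] :=
    (Relation.EqvGen.symm _ _ (.rel _ _ (.mk [] [.s, .t, .s]))).trans _ _ _
      (.rel _ _ (.mk [.s, .t, .s] []))
  fin_cases j
  iterate 6 exact .refl _
  exact h

theorem isDistinguishedSet_centralM :
    IsDistinguishedSet Set.univ stsWord stsBasis centralM := by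
  refine ⟨?_, fun g => ?_, fun g w => centralVec ξ₁ ξ₂
    (fun j => if classWord j = w then 1 else 0) (groupEquiv g), fun h => ?_⟩
  · simp only [centralM_eq_image, Finset.mem_image, Finset.mem_univ, true_and,
      forall_exists_index, forall_apply_eq_imp_iff]
    intro j
    rw [stsWord, groupEquiv_grp, wordAct_classWord]
    exact braidEquiv_classWord j
  · have hconj (j : Fin 7) : ConjUnder Set.univ (grp (classWord j)) g ↔ ∃ c,
        wordAct (basisWord c) (wordAct (classWord j) 0) =
          wordAct (basisWord (groupEquiv g)) c := by
      rw [← conjUnder_univ_iff, ← grp_eq_grp_basisWord, ← groupEquiv_symm_apply,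
        Equiv.symm_apply_apply]
    obtain ⟨j, hj, huniq⟩ := existsUnique_conj (groupEquiv g)
    refine ⟨classWord j, ⟨by simp [centralM_eq_image], (hconj j).mpr hj⟩, ?_⟩
    rintro w ⟨hw, hwg⟩
    rw [centralM_eq_image, Finset.mem_image] at hw
    obtain ⟨i, -, rfl⟩ := hw
    rw [huniq i ((hconj i).mp hwg)]
  · obtain ⟨r, rfl⟩ := exists_comb_eq h
    have hsum (g : W) : ∑ w ∈ centralM, centralVec ξ₁ ξ₂
        (fun j => if classWord j = w then 1 else 0) (groupEquiv g) *
          coeff stsBasis (comb gen r) w =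
        centralVec ξ₁ ξ₂ (fun j => r (classIndex j)) (groupEquiv g) := by
      rw [centralM_eq_image, Finset.sum_image classWord_injective.injOn]
      simp only [classWord_injective.eq_iff, coeff_comb, wordAct_classWord]
      exact sum_centralVec_single ξ₁ ξ₂ (fun j => r (classIndex j)) (groupEquiv g)
    have hrepr (g : W) : stsBasis.repr (comb gen r) g = r (groupEquiv g) := by
      obtain ⟨w, rfl⟩ := exists_grp_eq g
      rw [stsBasis_repr_grp, groupEquiv_grp]
    rw [parabolicCentralizer_univ, comb_mem_center_iff]
    simp only [hsum, hrepr]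
    constructor
    · exact fun h g _ => congrFun h (groupEquiv g)
    · intro h
      ext i : 1
      -- No relation is imposed at a representative, where the equation is an identity.
      by_cases hi : ∃ j, classIndex j = i
      · obtain ⟨j, rfl⟩ := hi
        rw [centralVec_classIndex]
      · have hg := h (groupEquiv.symm i)
        rw [Equiv.apply_symm_apply] at hg
        refine hg fun w hw hwi => hi ?_
        rw [centralM_eq_image, Finset.mem_image] at hw
        obtain ⟨j, -, rfl⟩ := hw
        refine ⟨j, ?_⟩
        rw [← wordAct_classWord, ← groupEquiv_grp, hwi, Equiv.apply_symm_apply]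

theorem classWord_mem (j : Fin 7) : classWord j ∈ centralM := by
  simp [centralM_eq_image]

/-- A central element is determined by its coefficients at the distinguished words, and these can
be prescribed. -/
noncomputable def centerEquiv :
    Subalgebra.center R H ≃ₗ[R] ({w : Word // w ∈ centralM} → R) where
  toFun h w := coeff stsBasis (h : H) w
  map_add' g h := by
    ext w : 1
    simp [coeff]
  map_smul' a h := by
    ext w : 1
    simp [coeff]
  invFun c := ⟨comb gen (centralVec ξ₁ ξ₂ fun j => c ⟨classWord j, classWord_mem j⟩), by
    simp only [comb_mem_center_iff, centralVec_classIndex]⟩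
  left_inv := by
    rintro ⟨h, hh⟩
    obtain ⟨r, rfl⟩ := exists_comb_eq h
    rw [comb_mem_center_iff] at hh
    simp only [coeff_comb, wordAct_classWord, ← hh]
  right_inv c := by
    ext ⟨w, hw⟩ : 1
    obtain ⟨j, -, rfl⟩ := Finset.mem_image.mp (centralM_eq_image ▸ hw)
    simp only [coeff_comb, wordAct_classWord, centralVec_classIndex]

end HeckeG4

/-- The words of `B_sts` are reduced words for the elements of `G₄` and give a basis `B` of the
Hecke algebra; an element is central if and only if its coefficients satisfy [C1] to [C14]; the set
`{1, s, s², ts, t²s, t²s², tststs}` is a distinguished set for the centre; and the centre has an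
`R`-basis indexed by it, whose member at `w` has coefficient `1` at `w` and `0` at the other
distinguished words. -/
theorem mainTheorem3 :
    ∃ (η : HeckeG4.W → HeckeG4.Word) (B : Module.Basis HeckeG4.W HeckeG4.R HeckeG4.H),
      Set.range η = HeckeG4.stsWords ∧
      HeckeG4.IsReducedBasis η B ∧
      (∀ h : HeckeG4.H, h ∈ Subalgebra.center HeckeG4.R HeckeG4.H ↔
        HeckeG4.CentralRelations (HeckeG4.coeff B h)) ∧
      HeckeG4.IsDistinguishedSet Set.univ η B HeckeG4.centralM ∧
      ∃ b : Module.Basis {w : HeckeG4.Word // w ∈ HeckeG4.centralM} HeckeG4.R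
          (Subalgebra.center HeckeG4.R HeckeG4.H),
        ∀ v w : {w : HeckeG4.Word // w ∈ HeckeG4.centralM},
          HeckeG4.coeff B (b v : HeckeG4.H) w = if v = w then 1 else 0 := by
  refine ⟨HeckeG4.stsWord, HeckeG4.stsBasis, HeckeG4.range_stsWord,
    HeckeG4.isReducedBasis_stsBasis, HeckeG4.mem_center_iff_centralRelations,
    HeckeG4.isDistinguishedSet_centralM, Module.Basis.ofEquivFun HeckeG4.centerEquiv,
    fun v w => ?_⟩
  -- The coordinates of this basis are the coefficients at the distinguished words, so the basis is
  -- dual to them.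
  have h := Module.Basis.equivFun_self (Module.Basis.ofEquivFun HeckeG4.centerEquiv) v w
  rwa [Module.Basis.equivFun_ofEquivFun] at h
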